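/- All matroids have finite ground sets and all lattices are finite. A matroid $M$ with ground set $E$ and rank function $r$ is simple if $r(A)=|A|$ for all $A\subseteq E$ with $|A|\le 2$. $\mathcal L(M)$ denotes its lattice of flats, ordered by inclusion. A geometric lattice is a graded atomistic lattice whose rank function satisfies $r(x\vee y)+r(x\wedge y)\le r(x)+r(y)$; its rank is $r(\hat 1)$, where $r(\hat 0)=0$. For a finite poset $L$ with least element $\hat 0$ and greatest element $\hat 1$, write $\mu(L)=\mu_L(\hat 0,\hat 1)$ for its Möbius function, and let $\tilde\chi(\mathcal O(L))=\sum_{\sigma}(-1)^{|\sigma|-1}$ be the reduced Euler characteristic of the order complex of the proper part $L\setminus\{\hat 0,\hat 1\}$, where $\sigma$ runs over all chains of the proper part, including the empty one. $B_d$ is the Boolean lattice of all subsets of a $d$-element set. **Theorem.** Let $k\ge 0$ be an integer. 1. For every integer $d\ge 0$, the number of isomorphism classes of simple matroids $M$ of rank $d$ with $|\mu(\mathcal L(M))|=k$ is finite. 2. The number of isomorphism classes of simple matroids $M$ without coloops, of any rank, with $|\mu(\mathcal L(M))|=k$ is finite. 3. For every integer $d\ge 0$, the number of isomorphism classes of geometric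 lattices $L$ of rank $d$ with $|\mu(L)|=k$ is finite. 4. There are finitely many geometric lattices $L_1,\dots,L_m$ such that every geometric lattice $L$ with $|\tilde\chi(\mathcal O(L))|=k$ is isomorphic to $L_i\times B_d$ for some $i\in\{1,\dots,m\}$ and some integer $d\ge 0$. -/

import Mathlib

universe u v

noncomputable section

/-! ### Möbius number and order complex of a finite bounded poset -/

open Classical in
/-- The Möbius number `μ(P) = μ(0̂, 1̂)` of a finite bounded poset. -/
def mobiusNumber (P : Type u) [PartialOrder P] [BoundedOrder P] [Finite P] : ℤ :=
  letI : Fintype P := Fintype.ofFinite P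
  letI : LocallyFiniteOrder P := Fintype.toLocallyFiniteOrder
  IncidenceAlgebra.mu ℤ (⊥ : P) (⊤ : P)

/-- The order complex of a poset: its (nonempty) faces are the nonempty finite chains. -/
def orderComplex (P : Type u) [PartialOrder P] : PreAbstractSimplicialComplex P where
  faces := {s | s.Nonempty ∧ IsChain (· ≤ ·) (s : Set P)}
  isRelLowerSet_faces := fun _ hs =>
    ⟨hs.1, fun _ hts ht => ⟨ht, hs.2.mono (by exact_mod_cast hts)⟩⟩

/-- The reduced Euler characteristic `∑ (-1) ^ dim σ` of a finite simplicial complex, the sum over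
all faces including the empty one. Mathlib's complexes do not list the empty face among their
faces; it has dimension `-1` and contributes the summand `-1`. -/
def reducedEulerChar {V : Type u} (K : PreAbstractSimplicialComplex V) : ℤ :=
  (∑ᶠ σ ∈ K.faces, (-1 : ℤ) ^ (σ.card - 1)) - 1

/-- The order complex of the proper part `P \ {0̂, 1̂}` of a bounded poset. -/
abbrev properOrderComplex (P : Type u) [PartialOrder P] [BoundedOrder P] :
    PreAbstractSimplicialComplex (Set.Ioo (⊥ : P) ⊤) :=
  orderComplex (Set.Ioo (⊥ : P) ⊤)

/-! ### Geometric lattices -/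

/-- A (finite) geometric lattice: graded, with semimodular rank function, and atomistic. In a
finite bounded poset a function that is `0` at the bottom and increases by exactly `1` along
every cover is the rank function, and it exists exactly when the poset is graded. -/
class IsGeometricLattice (L : Type u) [Lattice L] [BoundedOrder L] : Prop where
  finite : Finite L
  exists_rank : ∃ r : L → ℕ, r ⊥ = 0 ∧ (∀ x y : L, x ⋖ y → r y = r x + 1) ∧
    ∀ x y : L, r (x ⊔ y) + r (x ⊓ y) ≤ r x + r y
  atomistic : IsAtomistic L

/-- A bundled finite geometric lattice. -/
structure GeometricLattice : Type (u + 1) where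
  carrier : Type u
  [lattice : Lattice carrier]
  [boundedOrder : BoundedOrder carrier]
  [isGeometric : IsGeometricLattice carrier]

namespace GeometricLattice

instance : CoeSort GeometricLattice.{u} (Type u) := ⟨carrier⟩

attribute [instance] lattice boundedOrder isGeometric

instance (L : GeometricLattice.{u}) : Finite L := IsGeometricLattice.finite

/-- The rank of a geometric lattice: the length of a longest chain from bottom to top (so the
Boolean lattice on `d` atoms has rank `d`, and the one-point lattice has rank `0`). -/
def rank (L : GeometricLattice.{u}) : ℕ∞ := Order.height (⊤ : L)

instance setoid : Setoid GeometricLattice.{u} where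
  r L L' := Nonempty (L ≃o L')
  iseqv :=
    ⟨fun L => ⟨OrderIso.refl L⟩, fun ⟨e⟩ => ⟨e.symm⟩, fun ⟨e⟩ ⟨f⟩ => ⟨e.trans f⟩⟩

/-- Isomorphism classes of finite geometric lattices. -/
abbrev IsoClass : Type (u + 1) := Quotient GeometricLattice.setoid.{u}

end GeometricLattice

/-- The Boolean lattice `B_d` of all subsets of a `d`-element set. -/
abbrev BooleanLattice (d : ℕ) : Type := Set (Fin d)

/-! ### Matroids -/

namespace Matroid

/-- A matroid is simple if `r(A) = |A|` for all subsets `A` of the ground set with `|A| ≤ 2`. -/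
def IsSimple {α : Type u} (M : Matroid α) : Prop :=
  ∀ A ⊆ M.E, A.encard ≤ 2 → M.eRk A = A.encard

/-- The lattice of flats `ℒ(M)`, ordered by inclusion. -/
abbrev FlatLattice {α : Type u} (M : Matroid α) : Type u := {F : Set α // M.IsFlat F}

instance {α : Type u} (M : Matroid α) : BoundedOrder M.FlatLattice where
  top := ⟨M.E, M.ground_isFlat⟩
  le_top F := F.2.subset_ground
  bot := ⟨M.closure ∅, M.isFlat_closure ∅⟩
  bot_le F := by
    have h := M.closure_subset_closure (Set.empty_subset F.1)
    rw [F.2.closure] at h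
    exact h

instance {α : Type u} (M : Matroid α) [M.Finite] : Finite M.FlatLattice :=
  (M.ground_finite.finite_subsets.subset fun _ hF => hF.subset_ground :
    {F : Set α | M.IsFlat F}.Finite).to_subtype

/-- Two matroids are isomorphic if some bijection between their ground sets preserves and
reflects independence. -/
def Isomorphic {α : Type u} {β : Type v} (M : Matroid α) (N : Matroid β) : Prop :=
  ∃ e : M.E ≃ N.E, ∀ I : Set M.E,
    M.Indep (Subtype.val '' I) ↔ N.Indep (Subtype.val '' (e '' I))

end Matroid

/-- A bundled matroid with finite ground set. -/
structure FiniteMatroid : Type (u + 1) where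
  carrier : Type u
  matroid : Matroid carrier
  [finite : matroid.Finite]

namespace FiniteMatroid

attribute [instance] finite

instance setoid : Setoid FiniteMatroid.{u} where
  r M N := M.matroid.Isomorphic N.matroid
  iseqv :=
    { refl := fun M => ⟨Equiv.refl _, fun I => by simp⟩
      symm := fun ⟨e, he⟩ => ⟨e.symm, fun I => by
        rw [he (e.symm '' I), ← Set.image_comp e e.symm, e.self_comp_symm, Set.image_id]⟩
      trans := fun ⟨e, he⟩ ⟨f, hf⟩ => ⟨e.trans f, fun I => by
        rw [he I, hf (e '' I), ← Set.image_comp f e]; rfl⟩ }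

/-- Isomorphism classes of matroids on finite ground sets. -/
abbrev IsoClass : Type (u + 1) := Quotient FiniteMatroid.setoid.{u}

end FiniteMatroid

end

theorem strictMono_of_covBy_eq_add_one {L : Type u} [PartialOrder L] [Finite L] {r : L → ℕ}
     (hr : ∀ x y : L, x ⋖ y → r y = r x + 1) :
    StrictMono r := by
  intro x y
  induction x using WellFoundedGT.induction with
  | ind x ih =>
    intro hxy
    obtain ⟨z, hz, hzy⟩ := exists_covBy_le_of_lt hxy
    rcases hzy.eq_or_lt with rfl | hlt
    · rw [hr _ _ hz]; omega
    · have := ih z hz.lt hlt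
      rw [hr _ _ hz] at this; omega

section GeometricLatticeBasics

variable {L : Type u} [Lattice L] [BoundedOrder L] [IsGeometricLattice L]

namespace IsGeometricLattice

theorem covBy_sup_of_isAtom {x a : L} (ha : IsAtom a) (hax : ¬ a ≤ x) : x ⋖ x ⊔ a := by
  have := IsGeometricLattice.finite (L := L)
  obtain ⟨r, h0, hr, hsub⟩ := IsGeometricLattice.exists_rank (L := L)
  have hmono := strictMono_of_covBy_eq_add_one hr
  refine ⟨lt_of_le_of_ne le_sup_left fun h => hax (h ▸ le_sup_right), fun z hxz hz => ?_⟩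
  have h1 := hsub x a
  have h2 := hr _ _ (bot_covBy_iff.2 ha)
  have h3 := hmono hxz
  have h4 := hmono hz
  omega

theorem exists_isAtom_of_not_le {x y : L} (h : ¬ x ≤ y) : ∃ a, IsAtom a ∧ a ≤ x ∧ ¬ a ≤ y := by
  have := IsGeometricLattice.atomistic (L := L)
  by_contra! hc
  exact h (le_iff_atom_le_imp.2 hc)

/-- An element not above an atom `a` extends to a coatom avoiding `a`. -/
theorem exists_covBy_avoiding {x a z : L} (ha : IsAtom a) (hax : a ≤ x) (hzx : z ≤ x)
    (haz : ¬ a ≤ z) : ∃ y, z ≤ y ∧ y ⋖ x ∧ ¬ a ≤ y := by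
  have := IsGeometricLattice.finite (L := L)
  obtain ⟨y, hzy, hy⟩ := (Set.toFinite {y : L | y ≤ x ∧ ¬ a ≤ y}).exists_le_maximal ⟨hzx, haz⟩
  refine ⟨y, hzy, ?_, hy.prop.2⟩
  have hcov := covBy_sup_of_isAtom ha hy.prop.2
  suffices h : x ≤ y ⊔ a by
    rwa [le_antisymm (sup_le hy.prop.1 hax) h] at hcov
  by_contra hx
  obtain ⟨b, hb, hbx, hby⟩ := exists_isAtom_of_not_le hx
  have hby' : ¬ b ≤ y := fun h => hby (h.trans le_sup_left)
  have hcov' := covBy_sup_of_isAtom hb hby'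
  have hab : a ≤ y ⊔ b := by
    by_contra h
    exact hcov'.lt.not_ge (hy.le_of_ge ⟨sup_le hy.prop.1 hbx, h⟩ hcov'.le)
  rcases hcov'.eq_or_eq hcov.le (sup_le le_sup_left hab) with h | h
  · exact hcov.lt.ne' h
  · exact hby (h ▸ le_sup_right)

end IsGeometricLattice

end GeometricLatticeBasics

/-- `a` is an atom below `x` lying in the join of the other atoms below `x`. -/
def IsNoncoloop {L : Type u} [PartialOrder L] [OrderBot L] (x a : L) : Prop :=
  IsAtom a ∧ a ≤ x ∧ ∀ y ≤ x, ¬ a ≤ y → ∃ b, IsAtom b ∧ b ≤ x ∧ b ≠ a ∧ ¬ b ≤ y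

section Mobius

open IncidenceAlgebra

variable {L : Type u}

/-- Weisner's theorem for the lower intervals of a finite lattice. -/
theorem sum_mu_sup_eq_zero [Lattice L] [OrderBot L] [Fintype L] [LocallyFiniteOrder L]
    [DecidableEq L] [DecidableLE L] {a : L} (ha : ⊥ < a) (t : L) :
    ∑ y : L with y ⊔ a = t, mu ℤ ⊥ y = 0 := by
  induction t using WellFoundedLT.induction with
  | ind t ih =>
    by_cases hat : a ≤ t
    · have h1 : ∑ y ∈ Finset.Icc ⊥ t, mu ℤ ⊥ y = 0 := by
        rw [sum_Icc_mu_right, if_neg (ha.trans_le hat).ne]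
      have h2 : ∑ s ∈ Finset.Icc ⊥ t, ∑ y ∈ Finset.Icc ⊥ t with y ⊔ a = s, mu ℤ ⊥ y = 0 := by
        rw [Finset.sum_fiberwise_of_maps_to, h1]
        intro y hy
        simp only [Finset.mem_Icc, bot_le, true_and] at hy ⊢
        exact sup_le hy hat
      have h3 : ∀ s ∈ Finset.Icc ⊥ t, ∑ y ∈ Finset.Icc ⊥ t with y ⊔ a = s, mu ℤ ⊥ y =
          ∑ y : L with y ⊔ a = s, mu ℤ ⊥ y := by
        intro s hs
        congr 1
        ext y
        simp only [Finset.mem_filter, Finset.mem_Icc, bot_le, true_and, Finset.mem_univ,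
          and_iff_right_iff_imp] at hs ⊢
        rintro rfl
        exact le_sup_left.trans hs
      rw [Finset.sum_congr rfl h3, Finset.sum_eq_single t] at h2
      · exact h2
      · intro s hs hst
        simp only [Finset.mem_Icc, bot_le, true_and] at hs
        exact ih s (lt_of_le_of_ne hs hst)
      · simp
    · refine Finset.sum_eq_zero fun y hy => ?_
      simp only [Finset.mem_filter, Finset.mem_univ, true_and] at hy
      exact absurd (hy ▸ le_sup_right) hat

variable [Lattice L] [BoundedOrder L] [IsGeometricLattice L] [Fintype L] [LocallyFiniteOrder L]
    [DecidableEq L]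

open Classical in
/-- The coatoms of the interval `[⊥, x]` that avoid `a`. -/
noncomputable def coatomsAvoiding (x a : L) : Finset L := {y : L | y ⋖ x ∧ ¬ a ≤ y}

omit [IsGeometricLattice L] [LocallyFiniteOrder L] [DecidableEq L] [BoundedOrder L] in
theorem mem_coatomsAvoiding {x a y : L} : y ∈ coatomsAvoiding x a ↔ y ⋖ x ∧ ¬ a ≤ y := by
  simp [coatomsAvoiding]

theorem mu_eq_neg_sum_coatomsAvoiding {x a : L} (ha : IsAtom a) (hax : a ≤ x) :
    mu ℤ ⊥ x = - ∑ y ∈ coatomsAvoiding x a, mu ℤ ⊥ y := by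
  classical
  have h := sum_mu_sup_eq_zero ha.bot_lt x
  have hset : (Finset.univ.filter fun y : L => y ⊔ a = x) = insert x (coatomsAvoiding x a) := by
    ext y
    simp only [Finset.mem_filter, Finset.mem_univ, true_and, Finset.mem_insert,
      mem_coatomsAvoiding]
    constructor
    · rintro rfl
      by_cases hay : a ≤ y
      · left; exact (sup_eq_left.2 hay).symm
      · right; exact ⟨IsGeometricLattice.covBy_sup_of_isAtom ha hay, hay⟩
    · rintro (rfl | ⟨hy, hay⟩)
      · exact sup_eq_left.2 hax
      · rcases hy.eq_or_eq le_sup_left (sup_le hy.le hax) with h | h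
        · exact absurd (h ▸ le_sup_right) hay
        · exact h
  rw [hset, Finset.sum_insert fun h => (mem_coatomsAvoiding.1 h).1.lt.false] at h
  linarith

/-- The absolute value of the Möbius number of the interval `[⊥, x]`. -/
noncomputable def absMu (x : L) : ℕ := (mu ℤ ⊥ x).natAbs

theorem neg_one_pow_mul_mu_pos {r : L → ℕ} (hr : ∀ x y : L, x ⋖ y → r y = r x + 1)
    (h0 : r ⊥ = 0) (x : L) : 0 < (-1) ^ r x * mu ℤ ⊥ x := by
  induction x using WellFoundedLT.induction with
  | ind x ih =>
    by_cases hx : x = ⊥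
    · subst hx; simp [h0]
    obtain ⟨a, ha, hax, hab⟩ := IsGeometricLattice.exists_isAtom_of_not_le (x := x) (y := ⊥)
      (by simpa using hx)
    rw [mu_eq_neg_sum_coatomsAvoiding ha hax, mul_neg, ← neg_mul, Finset.mul_sum]
    have hterm : ∀ y ∈ coatomsAvoiding x a, 0 < -(-1) ^ r x * mu ℤ ⊥ y := by
      intro y hy
      rw [mem_coatomsAvoiding] at hy
      have := ih y hy.1.lt
      rw [hr _ _ hy.1, pow_succ]
      simpa using this
    refine Finset.sum_pos hterm ?_
    obtain ⟨y, -, hy⟩ := IsGeometricLattice.exists_covBy_avoiding ha hax bot_le hab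
    exact ⟨y, mem_coatomsAvoiding.2 hy⟩

theorem absMu_eq_neg_one_pow_mul {r : L → ℕ} (hr : ∀ x y : L, x ⋖ y → r y = r x + 1)
    (h0 : r ⊥ = 0) (x : L) : (absMu x : ℤ) = (-1) ^ r x * mu ℤ ⊥ x := by
  have h := neg_one_pow_mul_mu_pos hr h0 x
  rw [← abs_of_pos h, abs_mul, abs_pow]
  simp [absMu]

theorem absMu_pos (x : L) : 0 < absMu x := by
  obtain ⟨r, h0, hr, -⟩ := IsGeometricLattice.exists_rank (L := L)
  have h := neg_one_pow_mul_mu_pos hr h0 x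
  rw [← absMu_eq_neg_one_pow_mul hr h0] at h
  exact_mod_cast h

theorem absMu_eq_sum {x a : L} (ha : IsAtom a) (hax : a ≤ x) :
    absMu x = ∑ y ∈ coatomsAvoiding x a, absMu y := by
  obtain ⟨r, h0, hr, -⟩ := IsGeometricLattice.exists_rank (L := L)
  zify
  rw [absMu_eq_neg_one_pow_mul hr h0, mu_eq_neg_sum_coatomsAvoiding ha hax, mul_neg, ← neg_mul,
    Finset.mul_sum]
  refine Finset.sum_congr rfl fun y hy => ?_
  rw [absMu_eq_neg_one_pow_mul hr h0, hr _ _ (mem_coatomsAvoiding.1 hy).1, pow_succ]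
  simp

theorem card_coatomsAvoiding_le {x a : L} (ha : IsAtom a) (hax : a ≤ x) :
    (coatomsAvoiding x a).card ≤ absMu x := by
  rw [absMu_eq_sum ha hax, Finset.card_eq_sum_ones]
  exact Finset.sum_le_sum fun y _ => absMu_pos y

/-- A bound, in terms of the Möbius number, for the number of atoms that are not coloops. -/
def noncoloopBound : ℕ → ℕ
  | 0 => 0
  | k + 1 => 1 + (k + 1) * noncoloopBound k + (k + 1) ^ 2

omit [LocallyFiniteOrder L] [DecidableEq L] in
theorem exists_coatomsAvoiding_ne {x a y : L} (ha : IsNoncoloop x a)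
    (hy : y ∈ coatomsAvoiding x a) : ∃ y' ∈ coatomsAvoiding x a, y' ≠ y := by
  rw [mem_coatomsAvoiding] at hy
  obtain ⟨b, hb, hbx, hba, hby⟩ := ha.2.2 y hy.1.le hy.2
  obtain ⟨z, hbz, hz⟩ := IsGeometricLattice.exists_covBy_avoiding ha.1 ha.2.1 hbx
    fun h => hba (((hb.le_iff_eq ha.1.1).1 h).symm)
  exact ⟨z, mem_coatomsAvoiding.2 hz, fun h => hby (h ▸ hbz)⟩

theorem absMu_lt_of_mem_coatomsAvoiding {x a y : L} (ha : IsNoncoloop x a)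
    (hy : y ∈ coatomsAvoiding x a) : absMu y < absMu x := by
  obtain ⟨y', hy', hne⟩ := exists_coatomsAvoiding_ne ha hy
  rw [absMu_eq_sum ha.1 ha.2.1]
  exact Finset.single_lt_sum hne hy hy' (absMu_pos y') fun _ _ _ => Nat.zero_le _

omit [LocallyFiniteOrder L] [DecidableEq L] in
/-- A noncoloop `b` of `x` that becomes a coloop in a coatom `y` of `x` avoiding `a` is the only
atom of `y` outside `y ⊓ y'`, for some further coatom `y'` avoiding `a`. -/
theorem exists_coatomsAvoiding_inf {x a b y : L} (ha : IsNoncoloop x a) (hb : IsNoncoloop x b)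
    (hy : y ∈ coatomsAvoiding x a) (hby : b ≤ y) (hyb : ¬ IsNoncoloop y b) :
    ∃ y' ∈ coatomsAvoiding x a,
      ¬ b ≤ y ⊓ y' ∧ ∀ c, IsAtom c → c ≤ y → c ≠ b → c ≤ y ⊓ y' := by
  rw [mem_coatomsAvoiding] at hy
  simp only [IsNoncoloop, hb.1, hby, true_and] at hyb
  push Not at hyb
  obtain ⟨j, hjy, hbj, hj⟩ := hyb
  have hjb : j ⊔ b = y := by
    refine le_antisymm (sup_le hjy hby) ?_
    by_contra h
    obtain ⟨c, hc, hcy, hcj⟩ := IsGeometricLattice.exists_isAtom_of_not_le h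
    by_cases hcb : c = b
    · exact hcj (hcb ▸ le_sup_right)
    · exact hcj ((hj c hc hcy hcb).trans le_sup_left)
  have hjcov : j ⋖ y := hjb ▸ IsGeometricLattice.covBy_sup_of_isAtom hb.1 hbj
  have haj : ¬ a ≤ j := fun h => hy.2 (h.trans hjy)
  have hjacov := IsGeometricLattice.covBy_sup_of_isAtom ha.1 haj
  have hbja : ¬ b ≤ j ⊔ a := by
    intro h
    rcases hjacov.eq_or_eq hjcov.le (hjb ▸ sup_le le_sup_left h) with h | h
    · exact hjcov.lt.ne' h
    · exact hy.2 (h ▸ le_sup_right)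
  obtain ⟨c, hc, hcx, hcb, hcja⟩ := hb.2.2 (j ⊔ a) (sup_le (hjy.trans hy.1.le) ha.2.1) hbja
  have hcj : ¬ c ≤ j := fun h => hcja (h.trans le_sup_left)
  have hjccov := IsGeometricLattice.covBy_sup_of_isAtom hc hcj
  have hcy : ¬ c ≤ y := fun h => hcj (hj c hc h hcb)
  have hyc : y ⊔ c = x := (hy.1.eq_or_eq le_sup_left (sup_le hy.1.le hcx)).resolve_left
    fun h => hcy (h ▸ le_sup_right)
  have hbjc : ¬ b ≤ j ⊔ c := by
    intro h
    rcases hjccov.eq_or_eq hjcov.le (hjb ▸ sup_le le_sup_left h) with h | h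
    · exact hjcov.lt.ne' h
    · exact hcy (h ▸ le_sup_right)
  refine ⟨j ⊔ c, mem_coatomsAvoiding.2 ⟨?_, ?_⟩, fun h => hbjc (h.trans inf_le_right),
    fun d hd hdy hdb => le_inf hdy ((hj d hd hdy hdb).trans le_sup_left)⟩
  · have h := IsGeometricLattice.covBy_sup_of_isAtom hb.1 hbjc
    rwa [sup_right_comm, hjb, hyc] at h
  · intro h
    rcases hjccov.eq_or_eq hjacov.le (sup_le le_sup_left h) with h | h
    · exact hjacov.lt.ne' h
    · exact hcja (h ▸ le_sup_right)

/-- The number of atoms that are not coloops is bounded in terms of the Möbius number. -/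
theorem ncard_isNoncoloop_le (k : ℕ) (x : L) (hk : absMu x ≤ k) :
    {a | IsNoncoloop x a}.ncard ≤ noncoloopBound k := by
  classical
  induction k generalizing x with
  | zero => exact absurd hk (absMu_pos x).not_ge
  | succ k ih =>
    rcases Set.eq_empty_or_nonempty {a | IsNoncoloop x a} with h | ⟨a, ha⟩
    · simp [h]
    set H := coatomsAvoiding x a with hH
    have hHk : H.card ≤ k + 1 := (card_coatomsAvoiding_le ha.1 ha.2.1).trans hk
    let A : L → Finset L := fun y => {b | IsNoncoloop y b}
    let B : L × L → Finset L := fun p =>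
      {b | IsAtom b ∧ b ≤ p.1 ∧ ¬ b ≤ p.1 ⊓ p.2 ∧ ∀ c, IsAtom c → c ≤ p.1 → c ≠ b → c ≤ p.1 ⊓ p.2}
    have hA : ∀ y ∈ H, (A y).card ≤ noncoloopBound k := by
      intro y hy
      have h := ih y (by have := absMu_lt_of_mem_coatomsAvoiding ha hy; omega)
      rwa [Set.ncard_eq_toFinset_card', Set.toFinset_ofPred] at h
    have hB : ∀ p ∈ H ×ˢ H, (B p).card ≤ 1 := by
      intro p _
      rw [Finset.card_le_one]
      intro b hb c hc
      simp only [B, Finset.mem_filter, Finset.mem_univ, true_and] at hb hc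
      by_contra hne
      exact hb.2.2.1 (hc.2.2.2 b hb.1 hb.2.1 hne)
    have hsub : {b | IsNoncoloop x b} ⊆
        ((insert a (H.biUnion A ∪ (H ×ˢ H).biUnion B) : Finset L) : Set L) := by
      intro b hb
      simp only [Finset.coe_insert, Finset.coe_union, Set.mem_insert_iff, Set.mem_union,
        Finset.mem_coe, Finset.mem_biUnion]
      by_cases hba : b = a
      · exact Or.inl hba
      right
      obtain ⟨y, hby, hy⟩ := IsGeometricLattice.exists_covBy_avoiding ha.1 ha.2.1 hb.2.1
        fun h => hba (((hb.1.le_iff_eq ha.1.1).1 h).symm)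
      have hyH : y ∈ H := mem_coatomsAvoiding.2 hy
      by_cases hyb : IsNoncoloop y b
      · exact Or.inl ⟨y, hyH, by simpa [A] using hyb⟩
      · right
        obtain ⟨y', hy', h1, h2⟩ := exists_coatomsAvoiding_inf ha hb hyH hby hyb
        exact ⟨(y, y'), Finset.mem_product.2 ⟨hyH, hy'⟩, by
          simpa only [B, Finset.mem_filter, Finset.mem_univ, true_and] using ⟨hb.1, hby, h1, h2⟩⟩
    calc {b | IsNoncoloop x b}.ncard
        ≤ (insert a (H.biUnion A ∪ (H ×ˢ H).biUnion B)).card := by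
          rw [← Set.ncard_coe_finset]
          exact Set.ncard_le_ncard hsub (Finset.finite_toSet _)
      _ ≤ (H.card * noncoloopBound k + (H ×ˢ H).card * 1) + 1 := by
          refine (Finset.card_insert_le _ _).trans (Nat.add_le_add_right
            ((Finset.card_union_le _ _).trans (Nat.add_le_add ?_ ?_)) 1)
          · exact Finset.card_biUnion_le_card_mul _ _ _ hA
          · exact Finset.card_biUnion_le_card_mul _ _ _ hB
      _ ≤ noncoloopBound (k + 1) := by
          rw [Finset.card_product, noncoloopBound]
          nlinarith [Nat.mul_le_mul_right (noncoloopBound k) hHk, Nat.mul_le_mul hHk hHk]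

end Mobius

theorem ncard_isNoncoloop_top_le {L : Type u} [Lattice L] [BoundedOrder L] [IsGeometricLattice L]
    [Finite L] {k : ℕ} (hk : |mobiusNumber L| = k) :
    {a : L | IsNoncoloop ⊤ a}.ncard ≤ noncoloopBound k := by
  classical
  let _ : Fintype L := Fintype.ofFinite L
  let _ : LocallyFiniteOrder L := Fintype.toLocallyFiniteOrder
  refine ncard_isNoncoloop_le k ⊤ (le_of_eq ?_)
  zify
  rw [← hk, absMu, Int.natCast_natAbs, mobiusNumber]

section ColoopDecomposition

variable {L : Type u} [Lattice L] [BoundedOrder L]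

theorem exists_forall_isAtom_le_of_not_isNoncoloop {a : L} (ha : IsAtom a)
    (h : ¬ IsNoncoloop ⊤ a) : ∃ y, ¬ a ≤ y ∧ ∀ b, IsAtom b → b ≠ a → b ≤ y := by
  simp only [IsNoncoloop, ha, le_top, true_and, true_implies] at h
  push Not at h
  exact h

open Classical in
/-- The join of the atoms that are not coloops. -/
noncomputable def noncoloopJoin (L : Type u) [Lattice L] [BoundedOrder L] [Fintype L] : L :=
  ({a : L | IsNoncoloop ⊤ a} : Finset L).sup id

variable [Fintype L]

theorem noncoloopJoin_le {a y : L} (ha : ¬ IsNoncoloop ⊤ a)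
    (hy : ∀ b, IsAtom b → b ≠ a → b ≤ y) : noncoloopJoin L ≤ y := by
  refine Finset.sup_le fun b hb => ?_
  simp only [Finset.mem_filter, Finset.mem_univ, true_and] at hb
  exact hy b hb.1 fun h => ha (h ▸ hb)

theorem isAtom_le_noncoloopJoin_iff {b : L} (hb : IsAtom b) :
    b ≤ noncoloopJoin L ↔ IsNoncoloop ⊤ b := by
  constructor
  · intro h
    by_contra hc
    obtain ⟨y, hy, hy'⟩ := exists_forall_isAtom_le_of_not_isNoncoloop hb hc
    exact hy (h.trans (noncoloopJoin_le hc hy'))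
  · intro h
    exact Finset.le_sup (f := id) (by simpa using h)

variable [IsGeometricLattice L]

theorem mem_or_le_of_isAtom_le_sup {T : Finset L} (hT : ∀ a ∈ T, IsAtom a ∧ ¬ IsNoncoloop ⊤ a)
    {y b : L} (hy : y ≤ noncoloopJoin L) (hb : IsAtom b) (hby : b ≤ y ⊔ T.sup id) :
    b ∈ T ∨ b ≤ y := by
  classical
  induction T using Finset.induction_on with
  | empty => right; simpa using hby
  | insert a T haT ih =>
    by_cases hba : b = a
    · exact Or.inl (hba ▸ Finset.mem_insert_self _ _)
    have hT' : ∀ a ∈ T, IsAtom a ∧ ¬ IsNoncoloop ⊤ a :=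
      fun a ha => hT a (Finset.mem_insert_of_mem ha)
    obtain ⟨ha, hac⟩ := hT a (Finset.mem_insert_self _ _)
    obtain ⟨w, haw, hw⟩ := exists_forall_isAtom_le_of_not_isNoncoloop ha hac
    by_cases hbz : b ≤ y ⊔ T.sup id
    · exact (ih hT' hbz).imp_left Finset.mem_insert_of_mem
    exfalso
    have hzw : y ⊔ T.sup id ≤ w := sup_le (hy.trans (noncoloopJoin_le hac hw))
      (Finset.sup_le fun c hc => hw c (hT' c hc).1 fun h => haT (h ▸ hc))
    rw [Finset.sup_insert, id, sup_left_comm, sup_comm] at hby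
    have h1 := IsGeometricLattice.covBy_sup_of_isAtom hb hbz
    have h2 := IsGeometricLattice.covBy_sup_of_isAtom ha fun h => haw (h.trans hzw)
    rcases h2.eq_or_eq h1.le (sup_le le_sup_left hby) with h | h
    · exact h1.lt.ne' h
    · exact haw ((h ▸ le_sup_right : a ≤ y ⊔ T.sup id ⊔ b).trans (sup_le hzw (hw b hb hba)))

/-- A geometric lattice is the product of the interval below the join of its noncoloops and the
Boolean lattice on its coloops. -/
theorem nonempty_orderIso_prod_set (L : Type u) [Lattice L] [BoundedOrder L]
    [IsGeometricLattice L] [Fintype L] :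
    Nonempty (L ≃o Set.Iic (noncoloopJoin L) × Set {a : L | IsAtom a ∧ ¬ IsNoncoloop ⊤ a}) := by
  classical
  let f : L ↪o Set.Iic (noncoloopJoin L) × Set {a : L | IsAtom a ∧ ¬ IsNoncoloop ⊤ a} :=
    OrderEmbedding.ofMapLEIff (fun x => (⟨x ⊓ noncoloopJoin L, inf_le_right⟩, {a | a.1 ≤ x}))
      fun x x' => by
        constructor
        · rintro ⟨h1, h2⟩
          by_contra hx
          obtain ⟨b, hb, hbx, hbx'⟩ := IsGeometricLattice.exists_isAtom_of_not_le hx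
          by_cases hn : IsNoncoloop ⊤ b
          · exact hbx' ((le_inf hbx ((isAtom_le_noncoloopJoin_iff hb).2 hn)).trans
              ((Subtype.mk_le_mk.1 h1).trans inf_le_left))
          · exact hbx' (h2 (show (⟨b, hb, hn⟩ : {a : L | IsAtom a ∧ ¬ IsNoncoloop ⊤ a}) ∈
              {a : {a : L | IsAtom a ∧ ¬ IsNoncoloop ⊤ a} | a.1 ≤ x} from hbx))
        · intro h
          exact ⟨inf_le_inf_right _ h, fun a ha => le_trans ha h⟩
  refine ⟨RelIso.ofSurjective f ?_⟩
  rintro ⟨⟨y, hy⟩, S⟩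
  set T : Finset L := (S.toFinset.image Subtype.val) with hTdef
  have hT : ∀ a ∈ T, IsAtom a ∧ ¬ IsNoncoloop ⊤ a := by
    intro a ha
    obtain ⟨c, -, rfl⟩ := Finset.mem_image.1 ha
    exact c.2
  refine ⟨y ⊔ T.sup id, Prod.ext (Subtype.ext ?_) ?_⟩
  · show (y ⊔ T.sup id) ⊓ noncoloopJoin L = y
    refine le_antisymm ?_ (le_inf le_sup_left hy)
    by_contra h
    obtain ⟨b, hb, hbx, hby⟩ := IsGeometricLattice.exists_isAtom_of_not_le h
    rcases mem_or_le_of_isAtom_le_sup hT hy hb (hbx.trans inf_le_left) with h | h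
    · exact (hT b h).2 ((isAtom_le_noncoloopJoin_iff hb).1 (hbx.trans inf_le_right))
    · exact hby h
  · show {a : {a : L | IsAtom a ∧ ¬ IsNoncoloop ⊤ a} | a.1 ≤ y ⊔ T.sup id} = S
    ext a
    constructor
    · intro h
      rcases mem_or_le_of_isAtom_le_sup hT hy a.2.1 h with h | h
      · obtain ⟨c, hc, hca⟩ := Finset.mem_image.1 h
        rwa [← Subtype.ext hca, ← Set.mem_toFinset]
      · exact absurd ((isAtom_le_noncoloopJoin_iff a.2.1).1 (h.trans hy)) a.2.2
    · intro h
      have : a.1 ∈ T := Finset.mem_image.2 ⟨a, Set.mem_toFinset.2 h, rfl⟩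
      exact (Finset.le_sup (f := id) this).trans le_sup_right

end ColoopDecomposition

section Finiteness

instance IsGeometricLattice.Iic {L : Type u} [Lattice L] [BoundedOrder L] [IsGeometricLattice L]
    (e : L) : IsGeometricLattice (Set.Iic e) where
  finite := by
    have := IsGeometricLattice.finite (L := L)
    infer_instance
  exists_rank := by
    obtain ⟨r, h0, hr, hsub⟩ := IsGeometricLattice.exists_rank (L := L)
    exact ⟨fun x => r x, h0, fun x y h => hr _ _
      ((Set.OrdConnected.apply_covBy_apply_iff (OrderEmbedding.subtype _)
        (by
          rw [OrderEmbedding.coe_subtype, Subtype.range_coe]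
          exact Set.ordConnected_Iic)).2 h), fun x y => hsub x y⟩
  atomistic := by
    refine ⟨fun x => ⟨{a | IsAtom a ∧ a ≤ x}, ⟨fun a ha => ha.2, fun y hy => ?_⟩,
      fun a ha => ha.1⟩⟩
    by_contra h
    obtain ⟨b, hb, hbx, hby⟩ := IsGeometricLattice.exists_isAtom_of_not_le
      (x := x.1) (y := y.1) h
    exact hby (hy (a := ⟨b, hbx.trans x.2⟩) ⟨hb.Iic _, hbx⟩)

/-- A family of equivalence classes is finite if its members have codes in a finite type that
determine them. -/
theorem finite_setOf_quotient {X : Type*} [s : Setoid X] {Y : Type*} [Finite Y] (P : X → Prop)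
    (R : X → Y → Prop) (hP : ∀ x, P x → ∃ y, R x y)
    (hR : ∀ x x' y, R x y → R x' y → x ≈ x') :
    {c : Quotient s | ∃ x, c = ⟦x⟧ ∧ P x}.Finite := by
  choose f hf using hP
  have : ∀ c : {c : Quotient s | ∃ x, c = ⟦x⟧ ∧ P x}, ∃ x, c.1 = ⟦x⟧ ∧ P x := fun c => c.2
  choose g hg hgP using this
  refine Set.finite_coe_iff.1 (Finite.of_injective (fun c => f (g c) (hgP c)) fun c c' h => ?_)
  refine Subtype.ext ?_
  rw [hg c, hg c']
  refine Quotient.sound (hR _ _ (f (g c) (hgP c)) (hf _ (hgP c)) ?_)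
  have h : f (g c) (hgP c) = f (g c') (hgP c') := h
  rw [h]
  exact hf _ (hgP c')

theorem exists_orderIso_set_of_ncard_isAtom_le {L : Type u} [Lattice L] [BoundedOrder L]
    [IsGeometricLattice L] {n : ℕ} (hn : {a : L | IsAtom a}.ncard ≤ n) :
    ∃ T : Set (Set (Fin n)), Nonempty (L ≃o T) := by
  have := IsGeometricLattice.finite (L := L)
  obtain ⟨j⟩ : Nonempty ({a : L | IsAtom a} ↪ Fin n) := by
    refine ⟨(Finite.equivFin _).toEmbedding.trans (Fin.castLEEmb ?_)⟩
    simpa using hn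
  let f : L ↪o Set (Fin n) := OrderEmbedding.ofMapLEIff
    (fun x => j '' {a | a.1 ≤ x}) fun x y => by
      rw [Set.image_subset_image_iff j.injective]
      constructor
      · intro h
        by_contra hxy
        obtain ⟨b, hb, hbx, hby⟩ := IsGeometricLattice.exists_isAtom_of_not_le hxy
        exact hby (@h ⟨b, hb⟩ hbx)
      · exact fun h a ha => le_trans ha h
  exact ⟨Set.range f, ⟨f.orderIso⟩⟩

theorem finite_isoClass_ncard_isAtom_le (n : ℕ) :
    {c : GeometricLattice.IsoClass.{u} | ∃ L : GeometricLattice.{u}, c = ⟦L⟧ ∧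
      {a : L | IsAtom a}.ncard ≤ n}.Finite :=
  finite_setOf_quotient _ (fun L (T : Set (Set (Fin n))) => Nonempty (L ≃o T))
    (fun _ hL => exists_orderIso_set_of_ncard_isAtom_le hL)
    fun _ _ _ ⟨e⟩ ⟨e'⟩ => ⟨e.trans e'.symm⟩

theorem exists_family_ncard_isAtom_le (n : ℕ) :
    ∃ (m : ℕ) (Ls : Fin m → GeometricLattice.{u}), ∀ L : GeometricLattice.{u},
      {a : L | IsAtom a}.ncard ≤ n → ∃ i, Nonempty (L ≃o Ls i) := by
  have := (finite_isoClass_ncard_isAtom_le.{u} n).to_subtype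
  let e := Finite.equivFin {c : GeometricLattice.IsoClass.{u} | ∃ L : GeometricLattice.{u},
    c = ⟦L⟧ ∧ {a : L | IsAtom a}.ncard ≤ n}
  refine ⟨_, fun i => (e.symm i).1.out, fun L hL => ⟨e ⟨⟦L⟧, L, rfl, hL⟩, ?_⟩⟩
  have h : (e.symm (e ⟨⟦L⟧, L, rfl, hL⟩)).1 = ⟦L⟧ := congrArg Subtype.val (e.symm_apply_apply _)
  exact Quotient.exact (h.symm.trans (Quotient.out_eq _).symm)

/-- The product of two order isomorphisms. -/
def orderIsoProdCongr {α β γ δ : Type*} [LE α] [LE β] [LE γ] [LE δ] (f : α ≃o γ) (g : β ≃o δ) :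
    α × β ≃o γ × δ where
  toEquiv := f.toEquiv.prodCongr g.toEquiv
  map_rel_iff' := by simp [Prod.le_def]

theorem exists_family_prod_booleanLattice (k : ℕ) :
    ∃ (m : ℕ) (Ls : Fin m → GeometricLattice.{u}), ∀ L : GeometricLattice.{u},
      |mobiusNumber L| = k → ∃ (i : Fin m) (d : ℕ), Nonempty (L ≃o Ls i × BooleanLattice d) := by
  obtain ⟨m, Ls, h⟩ := exists_family_ncard_isAtom_le.{u} (noncoloopBound k)
  refine ⟨m, Ls, fun L hL => ?_⟩
  let _ : Fintype L := Fintype.ofFinite L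
  obtain ⟨e⟩ := nonempty_orderIso_prod_set L
  obtain ⟨i, ⟨f⟩⟩ := h ⟨Set.Iic (noncoloopJoin L)⟩ (by
    refine le_trans ?_ (ncard_isNoncoloop_top_le hL)
    refine Set.ncard_le_ncard_of_injOn Subtype.val (fun a ha => ?_)
      Subtype.val_injective.injOn (Set.toFinite _)
    exact (isAtom_le_noncoloopJoin_iff (IsAtom.of_isAtom_coe_Iic ha)).1 a.2)
  exact ⟨i, _, ⟨e.trans (orderIsoProdCongr f (Finite.equivFin _).toOrderIsoSet)⟩⟩

theorem le_rank_of_orderIso {L L' : GeometricLattice.{u}} {c : ℕ}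
    (e : L ≃o L' × BooleanLattice c) : (c : ℕ∞) ≤ L.rank := by
  let p : LTSeries L := LTSeries.mk c
    (fun j => e.symm (⊥, ({i | i.val < j.val} : Set (Fin c)))) (by
      refine e.symm.strictMono.comp fun i j hij => ?_
      refine Prod.mk_lt_mk.2 (Or.inr ⟨le_rfl, ?_⟩)
      refine ⟨fun l hl => lt_trans (Set.mem_ofPred.1 hl) hij, fun h => ?_⟩
      exact lt_irrefl i.val (@h ⟨i.val, by omega⟩ hij))
  exact Order.length_le_height (p := p) le_top

theorem finite_isoClass_rank (k d : ℕ) :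
    {c : GeometricLattice.IsoClass.{u} | ∃ L : GeometricLattice.{u}, c = ⟦L⟧ ∧
      L.rank = d ∧ |mobiusNumber L| = k}.Finite := by
  obtain ⟨m, Ls, h⟩ := exists_family_prod_booleanLattice.{u} k
  refine finite_setOf_quotient _ (fun L (p : Fin m × Fin (d + 1)) =>
    Nonempty (L ≃o Ls p.1 × BooleanLattice p.2)) ?_ fun _ _ _ ⟨e⟩ ⟨e'⟩ => ⟨e.trans e'.symm⟩
  rintro L ⟨hd, hk⟩
  obtain ⟨i, c, ⟨e⟩⟩ := h L hk
  have hc := le_rank_of_orderIso e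
  rw [hd, Nat.cast_le] at hc
  exact ⟨(i, ⟨c, by omega⟩), ⟨e⟩⟩

end Finiteness

section PhilipHall

open IncidenceAlgebra

variable {P : Type u} [PartialOrder P] [OrderBot P] [Fintype P]

open Classical in
/-- The chains of the open interval `(⊥, x)`, including the empty chain. -/
noncomputable def chainsBelow (x : P) : Finset (Finset P) :=
  {s | IsChain (· ≤ ·) (s : Set P) ∧ ∀ y ∈ s, ⊥ < y ∧ y < x}

theorem mem_chainsBelow {x : P} {s : Finset P} :
    s ∈ chainsBelow x ↔ IsChain (· ≤ ·) (s : Set P) ∧ ∀ y ∈ s, ⊥ < y ∧ y < x := by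
  simp [chainsBelow]

theorem chainsBelow_eq [LocallyFiniteOrder P] [DecidableEq P] (x : P) : chainsBelow x =
    insert ∅ ((Finset.Ioo ⊥ x).biUnion fun y => (chainsBelow y).image (insert y)) := by
  ext s
  simp only [Finset.mem_insert, Finset.mem_biUnion, Finset.mem_image, Finset.mem_Ioo,
    mem_chainsBelow]
  constructor
  · rintro ⟨hs, hsx⟩
    rcases s.eq_empty_or_nonempty with h | h
    · exact Or.inl h
    right
    obtain ⟨y, hy⟩ := s.exists_maximal h
    refine ⟨y, hsx y hy.prop, s.erase y, ⟨hs.mono (by simp), fun z hz => ?_⟩,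
      Finset.insert_erase hy.prop⟩
    obtain ⟨hzy, hz⟩ := Finset.mem_erase.1 hz
    refine ⟨(hsx z hz).1, lt_of_le_of_ne ?_ hzy⟩
    rcases hs.total hz hy.prop with h | h
    · exact h
    · exact hy.le_of_ge hz h
  · rintro (rfl | ⟨y, hy, t, ⟨ht, hty⟩, rfl⟩)
    · simp
    · refine ⟨?_, ?_⟩
      · rw [Finset.coe_insert]
        exact ht.insert fun z hz _ => Or.inr (hty z hz).2.le
      · intro z hz
        rcases Finset.mem_insert.1 hz with rfl | hz
        · exact hy
        · exact ⟨(hty z hz).1, (hty z hz).2.trans hy.2⟩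

theorem sum_chainsBelow [LocallyFiniteOrder P] [DecidableEq P] (x : P) :
    ∑ s ∈ chainsBelow x, (-1 : ℤ) ^ s.card =
      1 - ∑ y ∈ Finset.Ioo ⊥ x, ∑ s ∈ chainsBelow y, (-1 : ℤ) ^ s.card := by
  have hnot : ∀ {y : P} {s : Finset P}, s ∈ chainsBelow y → y ∉ s :=
    fun hs hy => ((mem_chainsBelow.1 hs).2 _ hy).2.false
  rw [chainsBelow_eq, Finset.sum_insert (by simp), Finset.sum_biUnion]
  · rw [Finset.card_empty, pow_zero, sub_eq_add_neg, ← Finset.sum_neg_distrib]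
    congr 1
    refine Finset.sum_congr rfl fun y _ => ?_
    rw [Finset.sum_image, ← Finset.sum_neg_distrib]
    · refine Finset.sum_congr rfl fun s hs => ?_
      rw [Finset.card_insert_of_notMem (hnot hs), pow_succ]
      ring
    · intro s hs t ht hst
      rw [← Finset.erase_insert (hnot hs), hst, Finset.erase_insert (hnot ht)]
  · intro y _ z _ hyz
    simp only [Function.onFun]
    rw [Finset.disjoint_left]
    intro s hs ht
    obtain ⟨s', hs', rfl⟩ := Finset.mem_image.1 hs
    obtain ⟨t', ht', h⟩ := Finset.mem_image.1 ht
    have hy : y ∈ t' := (Finset.mem_insert.1 (h ▸ Finset.mem_insert_self y s')).resolve_left hyz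
    have hz : z ∈ s' :=
      (Finset.mem_insert.1 (h.symm ▸ Finset.mem_insert_self z t')).resolve_left (Ne.symm hyz)
    exact lt_asymm ((mem_chainsBelow.1 ht').2 y hy).2 ((mem_chainsBelow.1 hs').2 z hz).2

/-- Philip Hall's theorem. -/
theorem mu_eq_neg_sum_chainsBelow [LocallyFiniteOrder P] [DecidableEq P] {x : P} (hx : ⊥ < x) :
    mu ℤ ⊥ x = - ∑ s ∈ chainsBelow x, (-1 : ℤ) ^ s.card := by
  induction x using WellFoundedLT.induction with
  | ind x ih =>
    rw [mu_eq_neg_sum_Ico_of_ne hx.ne, sum_chainsBelow, ← Finset.Ioo_insert_left hx,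
      Finset.sum_insert (by simp), mu_self, sub_eq_add_neg, ← Finset.sum_neg_distrib]
    congr 2
    refine Finset.sum_congr rfl fun y hy => ?_
    rw [Finset.mem_Ioo] at hy
    exact ih y hy.2 hy.1

theorem reducedEulerChar_properOrderComplex (P : Type u) [PartialOrder P] [BoundedOrder P]
    [Fintype P] : reducedEulerChar (properOrderComplex P) =
      - ∑ s ∈ chainsBelow (⊤ : P), (-1 : ℤ) ^ s.card := by
  classical
  have h : ∑ᶠ σ ∈ (properOrderComplex P).faces, (-1 : ℤ) ^ (σ.card - 1) =
      ∑ᶠ s ∈ (((chainsBelow (⊤ : P)).erase ∅ : Finset (Finset P)) : Set (Finset P)),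
        -(-1 : ℤ) ^ s.card := by
    refine finsum_mem_eq_of_bijOn (fun σ => σ.map (Function.Embedding.subtype _))
      ⟨?_, (Finset.map_injective _).injOn, ?_⟩ ?_
    · rintro σ ⟨hσ, hc⟩
      simp only [Finset.coe_erase, Set.mem_sdiff, Finset.mem_coe, mem_chainsBelow,
        Set.mem_singleton_iff, Finset.map_eq_empty]
      refine ⟨⟨?_, ?_⟩, hσ.ne_empty⟩
      · rw [Finset.coe_map]
        exact hc.image (OrderEmbedding.subtype _)
      · intro y hy
        obtain ⟨z, -, rfl⟩ := Finset.mem_map.1 hy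
        exact z.2
    · intro s hs
      simp only [Finset.coe_erase, Set.mem_sdiff, Finset.mem_coe, mem_chainsBelow,
        Set.mem_singleton_iff] at hs
      have hmap : (s.subtype (· ∈ Set.Ioo (⊥ : P) ⊤)).map (Function.Embedding.subtype _) = s :=
        Finset.subtype_map_of_mem hs.1.2
      refine ⟨_, ⟨?_, ?_⟩, hmap⟩
      · rw [← Finset.map_nonempty (f := Function.Embedding.subtype _), hmap]
        exact Finset.nonempty_iff_ne_empty.2 hs.2
      · intro x hx y hy hxy
        exact hs.1.1 (by simpa using hx) (by simpa using hy) fun h => hxy (Subtype.ext h)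
    · rintro σ ⟨hσ, -⟩
      rw [Finset.card_map]
      obtain ⟨n, hn⟩ := Nat.exists_eq_succ_of_ne_zero hσ.card_pos.ne'
      rw [hn, Nat.succ_sub_one, pow_succ]
      ring
  rw [reducedEulerChar, h, finsum_mem_coe_finset, Finset.sum_neg_distrib,
    ← Finset.add_sum_erase (chainsBelow (⊤ : P)) _
      (mem_chainsBelow.2 (by simp) : (∅ : Finset P) ∈ chainsBelow ⊤)]
  simp
  ring

theorem abs_reducedEulerChar_properOrderComplex (P : Type u) [PartialOrder P] [BoundedOrder P]
    [Finite P] : |reducedEulerChar (properOrderComplex P)| = |mobiusNumber P| := by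
  classical
  let _ : Fintype P := Fintype.ofFinite P
  let _ : LocallyFiniteOrder P := Fintype.toLocallyFiniteOrder
  have hmob : mobiusNumber P = mu ℤ (⊥ : P) ⊤ := by
    unfold mobiusNumber
    congr!
  rw [reducedEulerChar_properOrderComplex, hmob]
  rcases (bot_le : (⊥ : P) ≤ ⊤).eq_or_lt with h | h
  · have hch : chainsBelow (⊤ : P) = {∅} := by
      rw [chainsBelow_eq, ← h]
      simp
    rw [hch, ← h, mu_self]
    simp
  · rw [← mu_eq_neg_sum_chainsBelow h]

end PhilipHall

section Matroid

namespace Matroid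

variable {α : Type u} {M : Matroid α}

instance (M : Matroid α) : Lattice M.FlatLattice where
  sup F G := ⟨M.closure (F.1 ∪ G.1), M.isFlat_closure _⟩
  le_sup_left F G := Set.subset_union_left.trans
    (M.subset_closure _ (Set.union_subset F.2.subset_ground G.2.subset_ground))
  le_sup_right F G := Set.subset_union_right.trans
    (M.subset_closure _ (Set.union_subset F.2.subset_ground G.2.subset_ground))
  sup_le F G H hF hG := by
    have h := M.closure_subset_closure (Set.union_subset hF hG)
    rwa [H.2.closure] at h
  inf F G := ⟨F.1 ∩ G.1, by
    have h := IsFlat.iInter (M := M) (Fs := fun b : Bool => cond b F.1 G.1)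
      (by rintro (_ | _); exacts [G.2, F.2])
    rwa [← Set.inter_eq_iInter] at h⟩
  inf_le_left _ _ := Set.inter_subset_left
  inf_le_right _ _ := Set.inter_subset_right
  le_inf _ _ _ h h' := Set.subset_inter h h'

/-- The flat spanned by a single element. -/
def pointFlat (M : Matroid α) (e : α) : M.FlatLattice := ⟨M.closure {e}, M.isFlat_closure _⟩

theorem pointFlat_le_iff {e : α} (he : e ∈ M.E) {F : M.FlatLattice} :
    M.pointFlat e ≤ F ↔ e ∈ F.1 := by
  constructor
  · exact fun h => h (M.mem_closure_of_mem rfl (by simpa using he))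
  · intro h
    have := M.closure_subset_closure (Set.singleton_subset_iff.2 h)
    rwa [F.2.closure] at this

theorem isAtom_pointFlat {e : α} (he : e ∈ M.E) (h : e ∉ M.closure ∅) :
    IsAtom (M.pointFlat e) := by
  refine ⟨fun hbot => h ?_, fun F hF => ?_⟩
  · exact (pointFlat_le_iff he).1 hbot.le
  · refine le_bot_iff.1 fun f hf => ?_
    by_contra hf'
    refine hF.not_ge ((pointFlat_le_iff he).2 ?_)
    have h1 : f ∈ M.closure (insert e ∅) := by simpa [pointFlat] using hF.le hf
    have h2 := mem_closure_insert hf' h1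
    rw [insert_empty_eq] at h2
    exact (pointFlat_le_iff (F.2.subset_ground hf)).2 hf h2

instance (M : Matroid α) [M.Finite] : IsGeometricLattice M.FlatLattice where
  finite := inferInstance
  exists_rank := by
    have hfin : ∀ X : Set α, M.eRk X ≠ ⊤ := fun X =>
      ((M.eRk_le_eRank X).trans_lt (eRank_lt_top_iff.2 inferInstance)).ne
    refine ⟨fun F => (M.eRk F.1).toNat, ?_, fun F G h => ?_, fun F G => ?_⟩
    · show (M.eRk (M.closure ∅)).toNat = 0
      simp
    · obtain ⟨e, heG, heF⟩ := Set.exists_of_ssubset (show F.1 ⊂ G.1 from h.lt)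
      have heE := G.2.subset_ground heG
      have heq : F ⊔ M.pointFlat e = G := by
        refine (h.eq_or_eq le_sup_left (sup_le h.le ((pointFlat_le_iff heE).2 heG))).resolve_left
          fun h => heF ((pointFlat_le_iff heE).1 (h ▸ le_sup_right))
      have h1 : M.eRk G.1 = M.eRk F.1 + 1 := by
        rw [← eRk_insert_eq_add_one (e := e) (X := F.1) ⟨heE, by rwa [F.2.closure]⟩, ← heq]
        show M.eRk (M.closure (F.1 ∪ M.closure {e})) = _
        rw [eRk_closure_eq, eRk_union_closure_right_eq, Set.union_singleton]
      show (M.eRk G.1).toNat = _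
      rw [h1, ENat.toNat_add (hfin _) (by simp)]
      simp
    · show (M.eRk (M.closure (F.1 ∪ G.1))).toNat + (M.eRk (F.1 ∩ G.1)).toNat ≤ _
      rw [eRk_closure_eq, ← ENat.toNat_add (hfin _) (hfin _), ← ENat.toNat_add (hfin _) (hfin _),
        add_comm]
      exact ENat.toNat_le_toNat (M.eRk_inter_add_eRk_union_le _ _) (by simp [hfin])
  atomistic := by
    refine ⟨fun F => ⟨{A | IsAtom A ∧ A ≤ F}, ⟨fun A hA => hA.2, fun G hG e he => ?_⟩,
      fun A hA => hA.1⟩⟩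
    have heE := F.2.subset_ground he
    by_cases h : e ∈ M.closure ∅
    · exact (bot_le : ⊥ ≤ G) h
    · exact (pointFlat_le_iff heE).1 (hG ⟨isAtom_pointFlat heE h, (pointFlat_le_iff heE).2 he⟩)

theorem IsSimple.notMem_closure_empty (hM : M.IsSimple) {e : α} (he : e ∈ M.E) :
    e ∉ M.closure ∅ := by
  intro h
  have h1 := hM {e} (by simpa using he) (by simp)
  have h2 := M.eRk_mono (Set.singleton_subset_iff.2 h)
  rw [h1] at h2
  simp at h2

theorem IsSimple.closure_singleton (hM : M.IsSimple) {e : α} (he : e ∈ M.E) :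
    M.closure {e} = {e} := by
  refine Set.Subset.antisymm (fun f hf => ?_) (M.subset_closure _ (by simpa using he))
  by_contra hne
  have hfE := M.closure_subset_ground _ hf
  have hcard : ({f, e} : Set α).encard = 2 := Set.encard_pair hne
  have h1 := hM {f, e} (Set.pair_subset hfE he) hcard.le
  have h2 := M.eRk_mono (Set.pair_subset hf (M.mem_closure_of_mem rfl (by simpa using he)))
  rw [h1, hcard, eRk_closure_eq] at h2
  exact absurd (h2.trans (M.eRk_singleton_le e)) (by norm_num)

theorem IsSimple.isNoncoloop_pointFlat (hM : M.IsSimple) {e : α} (he : e ∈ M.E \ M.coloops) :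
    IsNoncoloop ⊤ (M.pointFlat e) := by
  refine ⟨isAtom_pointFlat he.1 (hM.notMem_closure_empty he.1), le_top, fun F _ hF => ?_⟩
  rw [pointFlat_le_iff he.1] at hF
  have hsub : ¬ M.E \ {e} ⊆ F.1 := by
    intro hsub
    refine he.2 ((isColoop_iff_notMem_closure_compl he.1).2 fun h => hF ?_)
    have := M.closure_subset_closure hsub h
    rwa [F.2.closure] at this
  obtain ⟨f, hf, hfF⟩ := Set.not_subset.1 hsub
  refine ⟨M.pointFlat f, isAtom_pointFlat hf.1 (hM.notMem_closure_empty hf.1), le_top,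
    fun h => hf.2 ?_, fun h => hfF ((pointFlat_le_iff hf.1).1 h)⟩
  have h := congrArg Subtype.val h
  simp only [pointFlat] at h
  rw [hM.closure_singleton hf.1, hM.closure_singleton he.1] at h
  exact h ▸ rfl

theorem IsSimple.ncard_ground_sdiff_coloops_le [M.Finite] (hM : M.IsSimple) {k : ℕ}
    (hk : |mobiusNumber M.FlatLattice| = k) : (M.E \ M.coloops).ncard ≤ noncoloopBound k := by
  refine le_trans ?_ (ncard_isNoncoloop_top_le hk)
  refine Set.ncard_le_ncard_of_injOn M.pointFlat (fun e he => hM.isNoncoloop_pointFlat he)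
    (fun e he f hf h => ?_) (Set.toFinite _)
  have h := congrArg Subtype.val h
  simp only [pointFlat] at h
  rw [hM.closure_singleton he.1, hM.closure_singleton hf.1] at h
  exact Set.singleton_injective h

theorem IsSimple.ncard_ground_le [M.Finite] (hM : M.IsSimple) {k : ℕ}
    (hk : |mobiusNumber M.FlatLattice| = k) :
    M.E.ncard ≤ noncoloopBound k + M.coloops.ncard := by
  have h := Set.ncard_sdiff_add_ncard_of_subset M.coloops_subset_ground M.ground_finite
  have := hM.ncard_ground_sdiff_coloops_le hk
  omega

end Matroid

theorem finite_isoClass_ncard_ground_le (n : ℕ) :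
    {c : FiniteMatroid.IsoClass.{u} | ∃ M : FiniteMatroid.{u}, c = ⟦M⟧ ∧
      M.matroid.E.ncard ≤ n}.Finite := by
  refine finite_setOf_quotient _ (fun M (p : Σ m : Fin (n + 1), Set (Set (Fin m))) =>
    ∃ e : M.matroid.E ≃ Fin p.1, ∀ I : Set M.matroid.E,
      M.matroid.Indep (Subtype.val '' I) ↔ e '' I ∈ p.2) ?_ ?_
  · intro M hM
    have := M.matroid.ground_finite.to_subtype
    let e := Finite.equivFin M.matroid.E
    refine ⟨⟨⟨Nat.card M.matroid.E, Nat.lt_succ_of_le hM⟩,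
      {J | M.matroid.Indep (Subtype.val '' (e.symm '' J))}⟩, e, fun I => ?_⟩
    rw [Set.mem_ofPred, Equiv.symm_image_image]
  · rintro M N ⟨m, T⟩ ⟨e, he⟩ ⟨f, hf⟩
    refine ⟨e.trans f.symm, fun I => ?_⟩
    rw [he, hf, ← Set.image_comp]
    congr! 2
    ext
    simp

end Matroid

theorem theorem1p3 (k : ℕ) :
    -- simple matroids of fixed rank
    (∀ d : ℕ, {c : FiniteMatroid.IsoClass.{u} | ∃ M : FiniteMatroid.{u}, c = ⟦M⟧ ∧
      M.matroid.IsSimple ∧ M.matroid.eRank = d ∧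
      |mobiusNumber M.matroid.FlatLattice| = k}.Finite) ∧
    -- simple coloop-free matroids of arbitrary rank
    {c : FiniteMatroid.IsoClass.{u} | ∃ M : FiniteMatroid.{u}, c = ⟦M⟧ ∧
      M.matroid.IsSimple ∧ M.matroid.coloops = ∅ ∧
      |mobiusNumber M.matroid.FlatLattice| = k}.Finite ∧
    -- geometric lattices of fixed rank
    (∀ d : ℕ, {c : GeometricLattice.IsoClass.{u} | ∃ L : GeometricLattice.{u}, c = ⟦L⟧ ∧
      L.rank = d ∧ |mobiusNumber L| = k}.Finite) ∧
    -- all geometric lattices, up to Boolean factors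
    ∃ (m : ℕ) (Ls : Fin m → GeometricLattice.{u}), ∀ L : GeometricLattice.{u},
      |reducedEulerChar (properOrderComplex L)| = k →
        ∃ (i : Fin m) (d : ℕ), Nonempty (L ≃o Ls i × BooleanLattice d) := by
  refine ⟨fun d => ?_, ?_, finite_isoClass_rank k, ?_⟩
  · refine (finite_isoClass_ncard_ground_le (noncoloopBound k + d)).subset ?_
    rintro c ⟨M, hc, hM, hd, hk⟩
    refine ⟨M, hc, (hM.ncard_ground_le hk).trans (Nat.add_le_add_left ?_ _)⟩
    have hfin := M.matroid.ground_finite.subset M.matroid.coloops_subset_ground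
    have h := M.matroid.coloops_indep.encard_le_eRank
    rw [hd, ← hfin.cast_ncard_eq] at h
    exact_mod_cast h
  · refine (finite_isoClass_ncard_ground_le (noncoloopBound k)).subset ?_
    rintro c ⟨M, hc, hM, hcol, hk⟩
    exact ⟨M, hc, by simpa [hcol] using hM.ncard_ground_le hk⟩
  · simpa only [abs_reducedEulerChar_properOrderComplex] using
      exists_family_prod_booleanLattice.{u} k
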